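/- Let $\mathcal X,\mathcal Y,\hat{\mathcal X}$ be finite non-empty alphabets, $P_{XY}$ a pmf on $\mathcal X\times\mathcal Y$, $d:\mathcal X\times\hat{\mathcal X}\to[0,\infty)$ a distortion function, and $\Delta\in\mathbb R$. Let $(X^n,Y^n)$ have the pmf $\prod_{i=1}^n P_{XY}(x_i,y_i)$, put $\bar d(x^n,\hat x^n)=\frac1n\sum_{i=1}^n d(x_i,\hat x_i)$, and for $R\in\mathbb R$ let $$p_{\mathrm c}(n,R,\Delta)=\max_{f_n,g_n}\mathbb P\{\bar d(X^n,g_n(f_n(Y^n)))\le\Delta\},$$ the maximum being over all encoders $f_n:\mathcal Y^n\to\{1,\dots,\lfloor 2^{nR}\rfloor\}$ and decoders $g_n:\{1,\dots,\lfloor 2^{nR}\rfloor\}\to\hat{\mathcal X}^n$. Logarithms are to base $2$, and $-\log 0=+\infty$. For a pmf $Q_{XY}$ on $\mathcal X\times\mathcal Y$ let $$R_{\mathrm c}(Q_{XY},\Delta)=\min_{Q_{\hat X|XY}:\ \mathbb E_Q[d(X,\hat X)]\le\Delta} I_Q(X;\hat X\mid Y)$$ be the conditional rate-distortion function, where $(X,Y,\hat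 X)$ has the pmf $Q_{XY}Q_{\hat X|XY}$; the minimum is attained if some $Q_{\hat X|XY}$ satisfies the constraint, and $R_{\mathrm c}(Q_{XY},\Delta)=+\infty$ otherwise. Then, for every $R\ge\log|\hat{\mathcal X}|$, the limit $E(R,\Delta)=\lim_{n\to\infty}-\frac1n\log p_{\mathrm c}(n,R,\Delta)$ exists in $[0,+\infty]$, and $$E(R,\Delta)=\min_{Q_{XY}}\bigl\{D(Q_{XY}\,\|\,P_{XY})+R_{\mathrm c}(Q_{XY},\Delta)\bigr\},$$ the minimum being over all pmfs $Q_{XY}$ on $\mathcal X\times\mathcal Y$ and attained, where $D$ is the relative entropy ($+\infty$ if $Q_{XY}\not\ll P_{XY}$). -/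

import Mathlib

open Filter Topology

namespace RemoteLossy

noncomputable section

variable {X Y Z : Type*}

/-- The per-letter distortion `(1/n) ∑ i, d (x i) (z i)` between two sequences of length `n`. -/
def avgDistortion (d : X → Z → ℝ) {n : ℕ} (x : Fin n → X) (z : Fin n → Z) : ℝ :=
  (1 / (n : ℝ)) * ∑ i, d (x i) (z i)

/-- The size `⌊2 ^ (n R)⌋` of the message set of a code of length `n` and rate `R`. -/
def numMessages (n : ℕ) (R : ℝ) : ℕ := ⌊(2 : ℝ) ^ ((n : ℝ) * R)⌋₊

/-- The probability that the distortion between `X^n` and `g (f (Y^n))` is at most `Δ`, for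
`(X^n, Y^n)` distributed as the `n`-fold product of the pmf `P`. -/
def successProb [Fintype X] [Fintype Y] (P : X × Y → ℝ) (d : X → Z → ℝ) (Δ : ℝ) {n M : ℕ}
    (f : (Fin n → Y) → Fin M) (g : Fin M → (Fin n → Z)) : ℝ :=
  ∑ x : Fin n → X, ∑ y : Fin n → Y,
    if avgDistortion d x (g (f y)) ≤ Δ then ∏ i, P (x i, y i) else 0

/-- The largest probability of correct reconstruction over all encoders `f` and decoders `g` of
length `n` and rate `R`. The supremum runs over a finite set of codes, so it is a maximum as soon
as a code exists. -/
def maxSuccessProb [Fintype X] [Fintype Y] (P : X × Y → ℝ) (d : X → Z → ℝ)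
    (n : ℕ) (R Δ : ℝ) : ℝ :=
  ⨆ c : ((Fin n → Y) → Fin (numMessages n R)) × (Fin (numMessages n R) → (Fin n → Z)),
    successProb P d Δ c.1 c.2

/-- `-(1/n) log₂ p` for a probability `p`, with value `+∞` at `p = 0`. -/
def decayRate (n : ℕ) (p : ℝ) : EReal :=
  if p = 0 then ⊤ else ((-(1 / (n : ℝ)) * Real.logb 2 p : ℝ) : EReal)

/-- `E` is the strong converse exponent: the limit of `-(1/n) log₂` of the largest probability of
correct reconstruction exists and is `E`. -/
def IsExponent [Fintype X] [Fintype Y] (P : X × Y → ℝ) (d : X → Z → ℝ) (R Δ : ℝ)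
    (E : EReal) : Prop :=
  Tendsto (fun n : ℕ => decayRate n (maxSuccessProb P d n R Δ)) atTop (𝓝 E)

open Classical in
/-- The relative entropy `D(Q ‖ P)` in bits of pmfs on a finite set, `+∞` unless `Q ≪ P`. -/
def relEntropy {A : Type*} [Fintype A] (Q P : A → ℝ) : EReal :=
  if ∀ a, P a = 0 → Q a = 0 then ((∑ a, Q a * Real.logb 2 (Q a / P a) : ℝ) : EReal) else ⊤

/-- The conditional mutual information `I(X; Z | Y)` in bits for `(X, Y, Z)` with joint pmf `T`.
A summand with `T x y z ≠ 0` has all three marginals positive. -/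
def condMutualInfo [Fintype X] [Fintype Y] [Fintype Z] (T : X → Y → Z → ℝ) : ℝ :=
  ∑ x, ∑ y, ∑ z, T x y z * Real.logb 2
    ((T x y z * ∑ x', ∑ z', T x' y z') / ((∑ z', T x y z') * ∑ x', T x' y z))

/-- The joint pmf of `(X, Y, Z)` if `(X, Y)` has pmf `Q` and `Z` is the output of the channel `W`
for the input `(X, Y)`. -/
def joint (Q : X × Y → ℝ) (W : X × Y → Z → ℝ) (x : X) (y : Y) (z : Z) : ℝ :=
  Q (x, y) * W (x, y) z

/-- The channels `W` from `X × Y` to `Z` for which the expected distortion between `X` and `Z` is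
at most `Δ`. -/
def feasibleChannels [Fintype X] [Fintype Y] [Fintype Z] (d : X → Z → ℝ) (Q : X × Y → ℝ)
    (Δ : ℝ) : Set (X × Y → Z → ℝ) :=
  {W | (∀ a, W a ∈ stdSimplex ℝ Z) ∧ ∑ x, ∑ y, ∑ z, joint Q W x y z * d x z ≤ Δ}

/-- The conditional rate-distortion function; it is `+∞` if no channel is feasible. -/
def condRateDistortion [Fintype X] [Fintype Y] [Fintype Z] (d : X → Z → ℝ) (Q : X × Y → ℝ)
    (Δ : ℝ) : EReal :=
  ⨅ W ∈ feasibleChannels d Q Δ, ((condMutualInfo (joint Q W) : ℝ) : EReal)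

end

end RemoteLossy

/-! For `R ≥ log |Z|` the messages can index all of `Z^n`, so a code is just a map `φ : Y^n → Z^n`.
For `T` the joint pmf of `(X, Y, Z)`, the quantity to minimise, D(T_XY ‖ P) + I(X; Z | Y), is the
mean under `T` of log (T(y) T(x|y,z) / P(x,y)) (`exponentObjective_eq`). It is continuous on the
compact set `feasibleJoints`, so a minimiser exists whenever that set is nonempty.

Converse (`exists_objective_le`), valid for every n ≥ 1: condition P^n on success, giving a law `q`
with D(q ‖ P^n) = -log S, where S is the success probability. Let `T` be the average letter law of
(X_i, Y_i, φ(Y^n)_i) under `q`. Since φ depends on y alone, ∏ T(y_i) T(x_i | y_i, φ(y)_i) is a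
subprobability, and Gibbs' inequality against it gives n · objective ≤ -log S.

Achievability (`eventually_exists_le_mapSuccessProb`): the best z for each y does at least as well
as z drawn from ∏ T(z_i | y_i). A change of measure to T^n costs about 2^(-n · objective) on typical
sequences. The distortion event is typical if the mean distortion is below `Δ`; `exists_slack_joint`
treats means equal to `Δ` by perturbation. -/

namespace RemoteLossy

variable {X Y Z : Type*}

/-! ### Chernoff bound, Gibbs' inequality and marginals -/

/-- Exponential moments of a weight function at the right of `0` if the mean is negative. -/
theorem exists_sum_mul_exp_lt_one {A : Type*} [Fintype A] {t h : A → ℝ}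
    (h1 : ∑ a, t a = 1) (hneg : ∑ a, t a * h a < 0) :
    ∃ c > 0, ∑ a, t a * Real.exp (c * h a) < 1 := by
  -- The moment generating function equals 1 at 0 with derivative the mean, so it dips below 1 just
  -- to the right of 0.
  have hder : HasDerivAt (fun c : ℝ => ∑ a, t a * Real.exp (c * h a)) (∑ a, t a * h a) 0 := by
    have := HasDerivAt.fun_sum (u := Finset.univ) (x := (0 : ℝ))
      (A := fun a c => t a * Real.exp (c * h a)) (A' := fun a => t a * h a) (fun a _ => by
        have := (((hasDerivAt_id (0 : ℝ)).mul_const (h a)).exp).const_mul (t a)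
        simpa using this)
    simpa using this
  have hs := hasDerivAt_iff_tendsto_slope.1 hder
  have hev := (hs.mono_left (nhdsGT_le_nhdsNE 0)).eventually_lt_const hneg
  obtain ⟨c, hc, hc0⟩ := (hev.and self_mem_nhdsWithin).exists
  have hc0' : (0 : ℝ) < c := hc0
  refine ⟨c, hc0', ?_⟩
  rw [slope_def_field] at hc
  have := (div_lt_iff₀ (by linarith : (0 : ℝ) < c - 0)).1 hc
  simp only [zero_mul, Real.exp_zero, mul_one, h1] at this
  linarith

theorem sum_pi_prod_eq_prod_sum {n : ℕ} {A : Type*} [Fintype A] (f : Fin n → A → ℝ) :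
    ∑ a : Fin n → A, ∏ i, f i (a i) = ∏ i, ∑ a, f i a := by
  classical
  rw [← Fintype.piFinset_univ, ← Finset.prod_univ_sum (fun _ : Fin n => Finset.univ) f]

/-- The probability that an i.i.d. sum with negative mean is positive tends to `0`. -/
theorem tendsto_sum_prod_of_mean_neg {A : Type*} [Fintype A] {t h : A → ℝ} (h0 : ∀ a, 0 ≤ t a)
    (h1 : ∑ a, t a = 1) (hneg : ∑ a, t a * h a < 0) :
    Tendsto (fun n : ℕ => ∑ a : Fin n → A, if 0 < ∑ i, h (a i) then ∏ i, t (a i) else 0)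
      atTop (𝓝 0) := by
  classical
  obtain ⟨c, hc, hlt⟩ := exists_sum_mul_exp_lt_one h1 hneg
  have hnn : 0 ≤ ∑ a, t a * Real.exp (c * h a) :=
    Finset.sum_nonneg fun a _ => mul_nonneg (h0 a) (Real.exp_pos _).le
  refine squeeze_zero (fun n => Finset.sum_nonneg fun a _ => ?_) (fun n => ?_)
    (tendsto_pow_atTop_nhds_zero_of_lt_one hnn hlt)
  · split_ifs
    · exact Finset.prod_nonneg fun i _ => h0 _
    · exact le_rfl
  · have : (∑ a, t a * Real.exp (c * h a)) ^ n
        = ∑ a : Fin n → A, ∏ i, (t (a i) * Real.exp (c * h (a i))) := by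
      rw [sum_pi_prod_eq_prod_sum fun _ a => t a * Real.exp (c * h a)]
      simp
    rw [this]
    refine Finset.sum_le_sum fun a _ => ?_
    rw [Finset.prod_mul_distrib, ← Real.exp_sum, ← Finset.mul_sum]
    have hp : 0 ≤ ∏ i, t (a i) := Finset.prod_nonneg fun i _ => h0 _
    split_ifs with hpos
    · exact le_mul_of_one_le_right hp (Real.one_le_exp (mul_pos hc hpos).le)
    · exact mul_nonneg hp (Real.exp_pos _).le

/-- Gibbs' inequality against a subprobability `r`. -/
theorem sum_mul_logb_div_nonpos {A : Type*} [Fintype A] {q r : A → ℝ} (hq : ∀ a, 0 ≤ q a)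
    (hr : ∀ a, 0 ≤ r a) (hpos : ∀ a, q a ≠ 0 → r a ≠ 0) (hle : ∑ a, r a ≤ ∑ a, q a) :
    ∑ a, q a * Real.logb 2 (r a / q a) ≤ 0 := by
  have hl : 0 < Real.log 2 := Real.log_pos one_lt_two
  have : ∑ a, q a * Real.log (r a / q a) ≤ ∑ a, (r a - q a) := by
    refine Finset.sum_le_sum fun a _ => ?_
    rcases eq_or_ne (q a) 0 with h | h
    · simp [h, hr a]
    · have hqa : 0 < q a := lt_of_le_of_ne (hq a) h.symm
      have hra : 0 < r a := lt_of_le_of_ne (hr a) (hpos a h).symm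
      have h2 := mul_le_mul_of_nonneg_left (Real.log_le_sub_one_of_pos (div_pos hra hqa)) hqa.le
      have h3 : q a * (r a / q a - 1) = r a - q a := by field_simp
      linarith
  have h4 : ∑ a, q a * Real.logb 2 (r a / q a)
      = (∑ a, q a * Real.log (r a / q a)) / Real.log 2 := by
    rw [Finset.sum_div]
    exact Finset.sum_congr rfl fun a _ => by rw [Real.logb, mul_div_assoc]
  rw [h4]
  refine div_nonpos_of_nonpos_of_nonneg (this.trans ?_) hl.le
  rw [Finset.sum_sub_distrib]
  linarith

theorem sum_pi_prod {n : ℕ} {A B : Type*} [Fintype A] [Fintype B] (f : (Fin n → A × B) → ℝ) :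
    ∑ a, f a = ∑ x : Fin n → A, ∑ y : Fin n → B, f fun i => (x i, y i) := by
  classical
  rw [← Fintype.sum_prod_type' (f := fun (x : Fin n → A) (y : Fin n → B) =>
    f fun i => (x i, y i))]
  exact (Equiv.sum_comp (Equiv.arrowProdEquivProdArrow (Fin n) (fun _ => A) (fun _ => B)).symm
    f).symm

/-- A positive entry of a nonnegative array has positive marginals. -/
theorem marginals_pos [Fintype X] [Fintype Z] {T : X → Y → Z → ℝ} (h0 : ∀ x y z, 0 ≤ T x y z)
    {x : X} {y : Y} {z : Z}
    (h : T x y z ≠ 0) : 0 < T x y z ∧ 0 < (∑ z', T x y z') ∧ 0 < (∑ x', T x' y z) ∧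
      0 < ∑ x', ∑ z', T x' y z' := by
  have hp : 0 < T x y z := lt_of_le_of_ne (h0 x y z) h.symm
  have hxy : T x y z ≤ ∑ z', T x y z' :=
    Finset.single_le_sum (f := fun z' => T x y z') (fun z' _ => h0 x y z') (Finset.mem_univ z)
  have hyz : T x y z ≤ ∑ x', T x' y z :=
    Finset.single_le_sum (f := fun x' => T x' y z) (fun x' _ => h0 x' y z) (Finset.mem_univ x)
  have hy : (∑ z', T x y z') ≤ ∑ x', ∑ z', T x' y z' :=
    Finset.single_le_sum (f := fun x' => ∑ z', T x' y z')
      (fun x' _ => Finset.sum_nonneg fun z' _ => h0 x' y z') (Finset.mem_univ x)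
  exact ⟨hp, by linarith, by linarith, by linarith⟩

theorem joint_nonneg [Fintype Z] {Q : X × Y → ℝ} (hQ : ∀ a, 0 ≤ Q a) {W : X × Y → Z → ℝ}
    (hW : ∀ a, W a ∈ stdSimplex ℝ Z) (x : X) (y : Y) (z : Z) : 0 ≤ joint Q W x y z :=
  mul_nonneg (hQ _) ((hW _).1 z)

theorem sum_joint [Fintype Z] {Q : X × Y → ℝ} {W : X × Y → Z → ℝ}
    (hW : ∀ a, W a ∈ stdSimplex ℝ Z) (x : X) (y : Y) : ∑ z, joint Q W x y z = Q (x, y) := by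
  simp only [joint, ← Finset.mul_sum, (hW (x, y)).2, mul_one]

/-! ### Continuity and compactness of the single-letter problem -/

section Information

variable [Fintype X] [Fintype Y] [Fintype Z]

theorem continuous_mul_logb : Continuous fun t : ℝ => t * Real.logb 2 t := by
  have : (fun t : ℝ => t * Real.logb 2 t) = fun t => t * Real.log t / Real.log 2 := by
    funext t; rw [Real.logb, mul_div_assoc]
  rw [this]
  exact Real.continuous_mul_log.div_const _

theorem continuous_mul_logb_div (p : ℝ) : Continuous fun t : ℝ => t * Real.logb 2 (t / p) := by
  rcases eq_or_ne p 0 with rfl | hp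
  -- Here `t / 0 = 0` and `Real.logb 2 0 = 0`, so the function is identically zero.
  · simpa using continuous_const
  · have : (fun t : ℝ => t * Real.logb 2 (t / p))
        = fun t => p * ((t / p) * Real.logb 2 (t / p)) := by
      funext t; field_simp
    rw [this]
    exact continuous_const.mul (continuous_mul_logb.comp (continuous_id.div_const p))

/-- Splitting into entropies leaves only terms t log t, which are continuous at t = 0, whereas the
quotient inside the original logarithm is not. -/
theorem condMutualInfo_eq {T : X → Y → Z → ℝ} (h0 : ∀ x y z, 0 ≤ T x y z) :
    condMutualInfo T = (∑ x, ∑ y, ∑ z, T x y z * Real.logb 2 (T x y z))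
      + (∑ y, (∑ x, ∑ z, T x y z) * Real.logb 2 (∑ x, ∑ z, T x y z))
      - (∑ x, ∑ y, (∑ z, T x y z) * Real.logb 2 (∑ z, T x y z))
      - ∑ y, ∑ z, (∑ x, T x y z) * Real.logb 2 (∑ x, T x y z) := by
  have hY : (∑ y, (∑ x, ∑ z, T x y z) * Real.logb 2 (∑ x, ∑ z, T x y z))
      = ∑ x, ∑ y, ∑ z, T x y z * Real.logb 2 (∑ x, ∑ z, T x y z) := by
    rw [Finset.sum_comm]
    simp only [Finset.sum_mul]
  have hXY : (∑ x, ∑ y, (∑ z, T x y z) * Real.logb 2 (∑ z, T x y z))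
      = ∑ x, ∑ y, ∑ z, T x y z * Real.logb 2 (∑ z, T x y z) := by
    simp only [Finset.sum_mul]
  have hYZ : (∑ y, ∑ z, (∑ x, T x y z) * Real.logb 2 (∑ x, T x y z))
      = ∑ x, ∑ y, ∑ z, T x y z * Real.logb 2 (∑ x, T x y z) := by
    rw [Finset.sum_comm (γ := X)]
    refine Finset.sum_congr rfl fun y _ => ?_
    rw [Finset.sum_comm (γ := X)]
    simp only [Finset.sum_mul]
  rw [hY, hXY, hYZ, condMutualInfo]
  simp only [← Finset.sum_add_distrib, ← Finset.sum_sub_distrib]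
  refine Finset.sum_congr rfl fun x _ => Finset.sum_congr rfl fun y _ =>
    Finset.sum_congr rfl fun z _ => ?_
  rcases eq_or_ne (T x y z) 0 with h | h
  · simp [h]
  · obtain ⟨a, b, c, e⟩ := marginals_pos h0 h
    rw [Real.logb_div (by positivity) (by positivity), Real.logb_mul a.ne' e.ne',
      Real.logb_mul b.ne' c.ne']
    ring

theorem continuousOn_condMutualInfo :
    ContinuousOn (condMutualInfo : (X → Y → Z → ℝ) → ℝ) {T | ∀ x y z, 0 ≤ T x y z} := by
  refine ContinuousOn.congr (Continuous.continuousOn ?_) fun T hT => condMutualInfo_eq hT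
  have hc := continuous_mul_logb
  refine ((Continuous.add ?_ ?_).sub ?_).sub ?_
  · exact continuous_finsetSum _ fun x _ => continuous_finsetSum _ fun y _ =>
      continuous_finsetSum _ fun z _ =>
        hc.comp (f := fun T : X → Y → Z → ℝ => T x y z) (by fun_prop)
  · exact continuous_finsetSum _ fun y _ =>
      hc.comp (f := fun T : X → Y → Z → ℝ => ∑ x, ∑ z, T x y z) (by fun_prop)
  · exact continuous_finsetSum _ fun x _ => continuous_finsetSum _ fun y _ =>
      hc.comp (f := fun T : X → Y → Z → ℝ => ∑ z, T x y z) (by fun_prop)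
  · exact continuous_finsetSum _ fun y _ => continuous_finsetSum _ fun z _ =>
      hc.comp (f := fun T : X → Y → Z → ℝ => ∑ x, T x y z) (by fun_prop)

/-- The objective `D(T_{XY} ‖ P) + I(X; Z | Y)` as a function of the joint pmf `T`; meaningful for
`T_{XY} ≪ P`. -/
noncomputable def exponentObjective (P : X × Y → ℝ) (T : X → Y → Z → ℝ) : ℝ :=
  (∑ x, ∑ y, (∑ z, T x y z) * Real.logb 2 ((∑ z, T x y z) / P (x, y))) + condMutualInfo T

/-- The density `log (T(y) T(x | y, z) / P(x, y))` whose mean is the objective. -/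
noncomputable def exponentDensity (P : X × Y → ℝ) (T : X → Y → Z → ℝ) (x : X) (y : Y) (z : Z) :
    ℝ :=
  Real.logb 2 (((∑ x', ∑ z', T x' y z') * T x y z) / ((∑ x', T x' y z) * P (x, y)))

/-- Joint pmfs of `(X, Y, Z)` that meet the distortion constraint and have `(X, Y)`-marginal
absolutely continuous with respect to `P`. -/
def feasibleJoints (P : X × Y → ℝ) (d : X → Z → ℝ) (Δ : ℝ) : Set (X → Y → Z → ℝ) :=
  {T | (∀ x y z, 0 ≤ T x y z) ∧ ∑ x, ∑ y, ∑ z, T x y z = 1 ∧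
    ∑ x, ∑ y, ∑ z, T x y z * d x z ≤ Δ ∧ ∀ x y z, P (x, y) = 0 → T x y z = 0}

theorem continuousOn_exponentObjective (P : X × Y → ℝ) :
    ContinuousOn (exponentObjective P : (X → Y → Z → ℝ) → ℝ) {T | ∀ x y z, 0 ≤ T x y z} := by
  refine ContinuousOn.add (Continuous.continuousOn ?_) continuousOn_condMutualInfo
  exact continuous_finsetSum _ fun x _ => continuous_finsetSum _ fun y _ =>
      (continuous_mul_logb_div _).comp (f := fun T : X → Y → Z → ℝ => ∑ z, T x y z) (by fun_prop)

/-- On the support of `T` the two logarithms merge and the marginal T(x,y) cancels. -/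
theorem exponentObjective_eq {P : X × Y → ℝ} (hP : ∀ a, 0 ≤ P a) {T : X → Y → Z → ℝ}
    (h0 : ∀ x y z, 0 ≤ T x y z) (hac : ∀ x y z, P (x, y) = 0 → T x y z = 0) :
    exponentObjective P T = ∑ x, ∑ y, ∑ z, T x y z * exponentDensity P T x y z := by
  unfold exponentObjective condMutualInfo exponentDensity
  simp only [Finset.sum_mul, ← Finset.sum_add_distrib]
  refine Finset.sum_congr rfl fun x _ => Finset.sum_congr rfl fun y _ =>
    Finset.sum_congr rfl fun z _ => ?_
  rcases eq_or_ne (T x y z) 0 with h | h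
  · simp [h]
  · obtain ⟨a, b, c, e⟩ := marginals_pos h0 h
    have hp : 0 < P (x, y) := lt_of_le_of_ne (hP _) fun hh => h (hac x y z hh.symm)
    simp only [← Finset.sum_mul]
    rw [← mul_add, ← Real.logb_mul (by positivity) (by positivity)]
    congr 2
    field_simp

/-- Absolute continuity is imposed as the vanishing of fixed coordinates, hence is a closed
condition. -/
theorem isCompact_feasibleJoints (P : X × Y → ℝ) (d : X → Z → ℝ) (Δ : ℝ) :
    IsCompact (feasibleJoints P d Δ) := by
  refine IsCompact.of_isClosed_subset (isCompact_Icc (a := (0 : X → Y → Z → ℝ)) (b := 1)) ?_ ?_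
  · have h : feasibleJoints P d Δ = (⋂ x, ⋂ y, ⋂ z, {T : X → Y → Z → ℝ | 0 ≤ T x y z}) ∩
        ({T | ∑ x, ∑ y, ∑ z, T x y z = 1} ∩ ({T | ∑ x, ∑ y, ∑ z, T x y z * d x z ≤ Δ} ∩
          ⋂ x, ⋂ y, ⋂ z, ⋂ _ : P (x, y) = 0, {T | T x y z = 0})) := by
      ext T; simp [feasibleJoints]
    rw [h]
    refine IsClosed.inter ?_ (IsClosed.inter ?_ (IsClosed.inter ?_ ?_))
    · exact isClosed_iInter fun x => isClosed_iInter fun y => isClosed_iInter fun z =>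
        isClosed_le continuous_const (by fun_prop)
    · exact isClosed_eq (by fun_prop) continuous_const
    · exact isClosed_le (by fun_prop) continuous_const
    · exact isClosed_iInter fun x => isClosed_iInter fun y => isClosed_iInter fun z =>
        isClosed_iInter fun _ => isClosed_eq (by fun_prop) continuous_const
  · rintro T ⟨h0, h1, -⟩
    refine ⟨fun x y z => h0 x y z, fun x y z => ?_⟩
    rw [Pi.one_apply, Pi.one_apply, Pi.one_apply, ← h1]
    calc T x y z ≤ ∑ z', T x y z' :=
          Finset.single_le_sum (f := fun z' => T x y z') (fun _ _ => h0 _ _ _) (Finset.mem_univ z)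
      _ ≤ ∑ y', ∑ z', T x y' z' :=
          Finset.single_le_sum (f := fun y' => ∑ z', T x y' z')
            (fun _ _ => Finset.sum_nonneg fun _ _ => h0 _ _ _) (Finset.mem_univ y)
      _ ≤ _ := Finset.single_le_sum (f := fun x' => ∑ y', ∑ z', T x' y' z')
            (fun _ _ => Finset.sum_nonneg fun _ _ => Finset.sum_nonneg fun _ _ => h0 _ _ _)
            (Finset.mem_univ x)

theorem isCompact_feasibleChannels (d : X → Z → ℝ) (Q : X × Y → ℝ) (Δ : ℝ) :
    IsCompact (feasibleChannels d Q Δ) := by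
  have h : feasibleChannels d Q Δ = Set.univ.pi (fun _ => stdSimplex ℝ Z) ∩
      {W | ∑ x, ∑ y, ∑ z, joint Q W x y z * d x z ≤ Δ} := by
    ext W; simp [feasibleChannels, Set.mem_pi]
  rw [h]
  refine (isCompact_univ_pi fun _ => isCompact_stdSimplex ℝ Z).inter_right ?_
  exact isClosed_le (by unfold joint; fun_prop) continuous_const

/-- The conditional rate-distortion function is attained. -/
theorem isLeast_condRateDistortion (d : X → Z → ℝ) {Q : X × Y → ℝ} (hQ : ∀ a, 0 ≤ Q a) {Δ : ℝ}
    (hne : (feasibleChannels d Q Δ).Nonempty) :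
    IsLeast ((fun W : X × Y → Z → ℝ => ((condMutualInfo (joint Q W) : ℝ) : EReal)) ''
      feasibleChannels d Q Δ) (condRateDistortion d Q Δ) := by
  have hc : ContinuousOn (fun W : X × Y → Z → ℝ => condMutualInfo (joint Q W))
      (feasibleChannels d Q Δ) :=
    continuousOn_condMutualInfo.comp
      (Continuous.continuousOn (by unfold joint; fun_prop)) fun W hW => joint_nonneg hQ hW.1
  obtain ⟨W, hW, hmin⟩ := (isCompact_feasibleChannels d Q Δ).exists_isMinOn hne hc
  have : condRateDistortion d Q Δ = ((condMutualInfo (joint Q W) : ℝ) : EReal) :=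
    le_antisymm (iInf₂_le W hW) (le_iInf₂ fun W' hW' => EReal.coe_le_coe_iff.2 (hmin hW'))
  rw [this]
  refine ⟨⟨W, hW, rfl⟩, ?_⟩
  rintro _ ⟨W', hW', rfl⟩
  exact EReal.coe_le_coe_iff.2 (hmin hW')

theorem joint_mem_feasibleJoints {P Q : X × Y → ℝ} (hQ : Q ∈ stdSimplex ℝ (X × Y))
    (hac : ∀ a, P a = 0 → Q a = 0) {d : X → Z → ℝ} {Δ : ℝ} {W : X × Y → Z → ℝ}
    (hW : W ∈ feasibleChannels d Q Δ) : joint Q W ∈ feasibleJoints P d Δ := by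
  refine ⟨joint_nonneg hQ.1 hW.1, ?_, hW.2, fun x y z h => ?_⟩
  · simp only [sum_joint hW.1]
    rw [← hQ.2, Fintype.sum_prod_type]
  · simp [joint, hac _ h]

theorem relEntropy_add_condMutualInfo {P Q : X × Y → ℝ} (hac : ∀ a, P a = 0 → Q a = 0)
    {W : X × Y → Z → ℝ} (hW : ∀ a, W a ∈ stdSimplex ℝ Z) :
    relEntropy Q P + ((condMutualInfo (joint Q W) : ℝ) : EReal)
      = ((exponentObjective P (joint Q W) : ℝ) : EReal) := by
  rw [relEntropy, if_pos hac, ← EReal.coe_add, exponentObjective]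
  simp only [sum_joint hW]
  rw [Fintype.sum_prod_type]

/-- Every feasible joint pmf comes from a pmf on `X × Y` and a feasible channel. -/
theorem exists_joint_eq [Nonempty Z] {P : X × Y → ℝ} {d : X → Z → ℝ} {Δ : ℝ}
    {T : X → Y → Z → ℝ} (hT : T ∈ feasibleJoints P d Δ) :
    ∃ Q ∈ stdSimplex ℝ (X × Y), (∀ a, P a = 0 → Q a = 0) ∧
      ∃ W ∈ feasibleChannels d Q Δ, joint Q W = T := by
  classical
  obtain ⟨h0, h1, hd, hac⟩ := hT
  let Q : X × Y → ℝ := fun a => ∑ z, T a.1 a.2 z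
  -- Where `Q` vanishes the conditional law is undetermined; any point mass serves.
  let W : X × Y → Z → ℝ := fun a => if Q a = 0 then Pi.single (Classical.arbitrary Z) 1
    else fun z => T a.1 a.2 z / Q a
  have hQ0 : ∀ a, 0 ≤ Q a := fun a => Finset.sum_nonneg fun z _ => h0 _ _ z
  have hj : joint Q W = T := by
    funext x y z
    by_cases h : Q (x, y) = 0
    · have := (Finset.sum_eq_zero_iff_of_nonneg fun z _ => h0 x y z).1 h z (Finset.mem_univ z)
      simp [joint, h, this]
    · simp only [joint, W, if_neg h]
      field_simp
  refine ⟨Q, ⟨hQ0, ?_⟩, fun a ha => Finset.sum_eq_zero fun z _ => hac _ _ z ha, W, ⟨?_, ?_⟩, hj⟩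
  · rw [Fintype.sum_prod_type]; exact h1
  · intro a
    by_cases h : Q a = 0
    · simp only [W, if_pos h]
      exact single_mem_stdSimplex ℝ _
    · simp only [W, if_neg h]
      refine ⟨fun z => div_nonneg (h0 _ _ z) (hQ0 a), ?_⟩
      rw [← Finset.sum_div]
      exact div_self h
  · rw [hj]; exact hd

end Information

/-! ### Reduction to unconstrained maps, converse and achievability -/

/-- The probability of meeting the distortion constraint with the reconstruction `φ (Y^n)`, where
`φ` is not subject to a rate constraint. -/
noncomputable def mapSuccessProb [Fintype X] [Fintype Y] (P : X × Y → ℝ) (d : X → Z → ℝ)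
    (Δ : ℝ) {n : ℕ} (φ : (Fin n → Y) → (Fin n → Z)) : ℝ :=
  ∑ x : Fin n → X, ∑ y : Fin n → Y,
    if avgDistortion d x (φ y) ≤ Δ then ∏ i, P (x i, y i) else 0

theorem mapSuccessProb_nonneg [Fintype X] [Fintype Y] {P : X × Y → ℝ} (hP : ∀ a, 0 ≤ P a)
    (d : X → Z → ℝ) (Δ : ℝ) {n : ℕ} (φ : (Fin n → Y) → (Fin n → Z)) : 0 ≤ mapSuccessProb P d Δ φ := by
  refine Finset.sum_nonneg fun x _ => Finset.sum_nonneg fun y _ => ?_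
  split_ifs
  · exact Finset.prod_nonneg fun i _ => hP _
  · exact le_rfl

theorem card_pow_le_numMessages [Fintype Z] [Nonempty Z] {R : ℝ}
    (hR : Real.logb 2 (Fintype.card Z : ℝ) ≤ R) (n : ℕ) :
    Fintype.card (Fin n → Z) ≤ numMessages n R := by
  have hc : (0 : ℝ) < Fintype.card Z := by exact_mod_cast Fintype.card_pos
  refine Nat.le_floor ?_
  rw [Fintype.card_fun, Fintype.card_fin, Nat.cast_pow, mul_comm, Real.rpow_mul (by norm_num),
    Real.rpow_natCast]
  exact pow_le_pow_left₀ hc.le ((Real.logb_le_iff_le_rpow one_lt_two hc).1 hR) n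

section Coding

variable [Fintype X] [Fintype Y] [Fintype Z]

/-- The encoder sends the index of `φ y` and the decoder inverts the indexing. -/
theorem mapSuccessProb_le_max [Nonempty Z] (P : X × Y → ℝ) (d : X → Z → ℝ) {R : ℝ}
    (hR : Real.logb 2 (Fintype.card Z : ℝ) ≤ R) (Δ : ℝ) {n : ℕ}
    (φ : (Fin n → Y) → (Fin n → Z)) : mapSuccessProb P d Δ φ ≤ maxSuccessProb P d n R Δ := by
  obtain ⟨e⟩ : Nonempty ((Fin n → Z) ↪ Fin (numMessages n R)) :=
    Function.Embedding.nonempty_of_card_le (by simpa using card_pow_le_numMessages hR n)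
  have := le_ciSup (f := fun c : ((Fin n → Y) → Fin (numMessages n R)) ×
      (Fin (numMessages n R) → (Fin n → Z)) => successProb P d Δ c.1 c.2)
    (Set.finite_range _).bddAbove (fun y => e (φ y), Function.invFun e)
  refine le_of_eq_of_le ?_ this
  simp only [mapSuccessProb, successProb, Function.leftInverse_invFun e.injective (φ _)]

theorem exists_mapSuccessProb_eq_max [Nonempty Z] (P : X × Y → ℝ) (d : X → Z → ℝ) {R : ℝ}
    (hR : Real.logb 2 (Fintype.card Z : ℝ) ≤ R) (Δ : ℝ) (n : ℕ) :
    ∃ φ : (Fin n → Y) → (Fin n → Z), mapSuccessProb P d Δ φ = maxSuccessProb P d n R Δ := by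
  have hM : 0 < numMessages n R := Fintype.card_pos.trans_le (card_pow_le_numMessages hR n)
  have : Nonempty (Fin (numMessages n R)) := ⟨⟨0, hM⟩⟩
  obtain ⟨c, hc⟩ := exists_eq_ciSup_of_finite
    (f := fun c : ((Fin n → Y) → Fin (numMessages n R)) ×
      (Fin (numMessages n R) → (Fin n → Z)) => successProb P d Δ c.1 c.2)
  exact ⟨fun y => c.2 (c.1 y), hc⟩

/-- Turns single-letter expectations under the averaged empirical law into `q`-averages of sums
along the sequence. -/
theorem sum_empirical_mul {A B I : Type*} [Fintype A] [Fintype B] [Fintype I] [DecidableEq B]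
    (q : A → ℝ) (c : ℝ) (e : A → I → B) (h : B → ℝ) :
    ∑ b, (∑ p, q p * (c * ∑ i, if e p i = b then 1 else 0)) * h b
      = ∑ p, q p * (c * ∑ i, h (e p i)) := by
  simp only [Finset.sum_mul, Finset.mul_sum]
  rw [Finset.sum_comm]
  refine Finset.sum_congr rfl fun p _ => ?_
  rw [Finset.sum_comm]
  refine Finset.sum_congr rfl fun i _ => ?_
  rw [Finset.sum_eq_single (e p i)]
  · simp [mul_assoc]
  · intro b _ hb; simp [hb.symm]
  · simp

/-- The memoryless law with letters `T(y) T(x | y, φ(y)_i)` is a subprobability. -/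
theorem sum_prod_letter_le_one {T : X → Y → Z → ℝ} (h0 : ∀ x y z, 0 ≤ T x y z)
    (h1 : ∑ x, ∑ y, ∑ z, T x y z = 1) {n : ℕ} (φ : (Fin n → Y) → (Fin n → Z)) :
    ∑ p : (Fin n → X) × (Fin n → Y), ∏ i, ((∑ x, ∑ z, T x (p.2 i) z) *
      T (p.1 i) (p.2 i) (φ p.2 i) / ∑ x, T x (p.2 i) (φ p.2 i)) ≤ 1 := by
  have hY : ∀ y, 0 ≤ ∑ x, ∑ z, T x y z := fun y =>
    Finset.sum_nonneg fun x _ => Finset.sum_nonneg fun z _ => h0 x y z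
  rw [Fintype.sum_prod_type_right]
  calc ∑ y : Fin n → Y, ∑ x : Fin n → X, ∏ i, ((∑ x, ∑ z, T x (y i) z) *
        T (x i) (y i) (φ y i) / ∑ x, T x (y i) (φ y i))
      ≤ ∑ y : Fin n → Y, ∏ i, ∑ x, ∑ z, T x (y i) z := by
        refine Finset.sum_le_sum fun y _ => ?_
        rw [sum_pi_prod_eq_prod_sum (fun i a => (∑ x, ∑ z, T x (y i) z) *
          T a (y i) (φ y i) / ∑ x, T x (y i) (φ y i))]
        refine Finset.prod_le_prod (fun i _ => Finset.sum_nonneg fun a _ => ?_) fun i _ => ?_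
        · exact div_nonneg (mul_nonneg (hY _) (h0 _ _ _)) (Finset.sum_nonneg fun x _ => h0 _ _ _)
        -- Summing T(x|y,z) over x gives 1, or 0 if T(y,z) = 0; hence only an inequality.
        · rw [← Finset.sum_div, ← Finset.mul_sum, mul_div_assoc]
          exact mul_le_of_le_one_right (hY _) (div_self_le_one _)
    _ = 1 := by
        rw [sum_pi_prod_eq_prod_sum (fun _ y => ∑ x, ∑ z, T x y z)]
        rw [Finset.sum_comm] at h1
        simp [h1]

/-- Converse: every reconstruction map with positive success probability yields a feasible joint
pmf whose objective is at most the decay rate. -/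
theorem exists_objective_le {P : X × Y → ℝ} (hP : ∀ a, 0 ≤ P a) (d : X → Z → ℝ) (Δ : ℝ) {n : ℕ}
    (hn : n ≠ 0) (φ : (Fin n → Y) → (Fin n → Z)) (hS : 0 < mapSuccessProb P d Δ φ) :
    ∃ T ∈ feasibleJoints P d Δ,
      exponentObjective P T ≤ -(1 / (n : ℝ)) * Real.logb 2 (mapSuccessProb P d Δ φ) := by
  classical
  set S := mapSuccessProb P d Δ φ with hSdef
  have hn' : (0 : ℝ) < n := by positivity
  let w : (Fin n → X) × (Fin n → Y) → ℝ := fun p =>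
    if avgDistortion d p.1 (φ p.2) ≤ Δ then ∏ i, P (p.1 i, p.2 i) else 0
  -- The source law conditioned on success.
  let q : (Fin n → X) × (Fin n → Y) → ℝ := fun p => w p / S
  have hw0 : ∀ p, 0 ≤ w p := fun p => by
    simp only [w]; split_ifs
    · exact Finset.prod_nonneg fun i _ => hP _
    · exact le_rfl
  have hq0 : ∀ p, 0 ≤ q p := fun p => div_nonneg (hw0 p) hS.le
  have hq1 : ∑ p, q p = 1 := by
    simp only [q, ← Finset.sum_div]
    rw [Fintype.sum_prod_type]
    exact div_self hS.ne'
  have hqne : ∀ p, q p ≠ 0 → avgDistortion d p.1 (φ p.2) ≤ Δ ∧ w p = ∏ i, P (p.1 i, p.2 i) ∧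
      ∀ i, P (p.1 i, p.2 i) ≠ 0 := fun p hp => by
    have hwp : w p ≠ 0 := fun h => hp (by simp [q, h])
    by_cases hd : avgDistortion d p.1 (φ p.2) ≤ Δ
    · have : w p = ∏ i, P (p.1 i, p.2 i) := if_pos hd
      refine ⟨hd, this, fun i hi => hwp ?_⟩
      rw [this]
      exact Finset.prod_eq_zero (Finset.mem_univ i) hi
    · exact absurd (if_neg hd) hwp
  let e : (Fin n → X) × (Fin n → Y) → Fin n → X × Y × Z := fun p i => (p.1 i, p.2 i, φ p.2 i)
  let T : X → Y → Z → ℝ := fun x y z =>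
    ∑ p, q p * (1 / (n : ℝ) * ∑ i, if e p i = (x, y, z) then 1 else 0)
  have hexp : ∀ h : X → Y → Z → ℝ, ∑ x, ∑ y, ∑ z, T x y z * h x y z
      = ∑ p, q p * (1 / (n : ℝ) * ∑ i, h (p.1 i) (p.2 i) (φ p.2 i)) := fun h => by
    have := sum_empirical_mul q (1 / (n : ℝ)) e (fun b => h b.1 b.2.1 b.2.2)
    rw [Fintype.sum_prod_type] at this
    simp only [Fintype.sum_prod_type (α₁ := Y)] at this
    exact this
  -- Every letter triple occurring with positive `q`-probability lies in the support of `T`, so all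
  -- logarithms below have positive arguments.
  have hTq : ∀ p i x y z, e p i = (x, y, z) → q p * (1 / (n : ℝ)) ≤ T x y z := by
    intro p i x y z hi
    have hite : ∀ p j, (0 : ℝ) ≤ if e p j = (x, y, z) then 1 else 0 := fun p j => by
      split_ifs <;> norm_num
    refine le_trans ?_ (Finset.single_le_sum (f := fun p =>
      q p * (1 / (n : ℝ) * ∑ i, if e p i = (x, y, z) then 1 else 0)) (fun p _ => ?_)
      (Finset.mem_univ p))
    · refine mul_le_mul_of_nonneg_left (le_mul_of_one_le_right (by positivity) ?_) (hq0 p)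
      refine le_trans ?_ (Finset.single_le_sum (f := fun i =>
        if e p i = (x, y, z) then (1 : ℝ) else 0) (fun j _ => hite p j) (Finset.mem_univ i))
      simp [hi]
    · exact mul_nonneg (hq0 p) (mul_nonneg (by positivity) (Finset.sum_nonneg fun j _ => hite p j))
  have hT0 : ∀ x y z, 0 ≤ T x y z := fun x y z =>
    Finset.sum_nonneg fun p _ => mul_nonneg (hq0 p) (mul_nonneg (by positivity)
      (Finset.sum_nonneg fun j _ => by split_ifs <;> norm_num))
  have hT1 : ∑ x, ∑ y, ∑ z, T x y z = 1 := by
    have := hexp fun _ _ _ => 1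
    simp only [mul_one, Finset.sum_const, Finset.card_univ, Fintype.card_fin, nsmul_eq_mul] at this
    rw [this]
    simpa [hn'.ne'] using hq1
  have hTac : ∀ x y z, P (x, y) = 0 → T x y z = 0 := fun x y z hxy => by
    refine Finset.sum_eq_zero fun p _ => ?_
    by_cases hp : q p = 0
    · simp [hp]
    · have : ∀ i, e p i ≠ (x, y, z) := fun i hi => by
        simp only [e, Prod.mk.injEq] at hi
        exact (hqne p hp).2.2 i (by rw [hi.1, hi.2.1, hxy])
      simp [this]
  clear_value T
  refine ⟨T, ⟨hT0, hT1, ?_, hTac⟩, ?_⟩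
  · rw [hexp fun x _ z => d x z]
    calc _ ≤ ∑ p, q p * Δ := by
          refine Finset.sum_le_sum fun p _ => ?_
          by_cases hp : q p = 0
          · simp [hp]
          · exact mul_le_mul_of_nonneg_left (hqne p hp).1 (hq0 p)
      _ = Δ := by rw [← Finset.sum_mul, hq1, one_mul]
  · let r : (Fin n → X) × (Fin n → Y) → ℝ := fun p => ∏ i, ((∑ x, ∑ z, T x (p.2 i) z) *
      T (p.1 i) (p.2 i) (φ p.2 i) / ∑ x, T x (p.2 i) (φ p.2 i))
    have hmarg : ∀ p, q p ≠ 0 → ∀ i, T (p.1 i) (p.2 i) (φ p.2 i) ≠ 0 := fun p hp i => by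
      have h1 := hTq p i _ _ _ rfl
      have h2 : 0 < q p * (1 / (n : ℝ)) :=
        mul_pos (lt_of_le_of_ne (hq0 p) (Ne.symm hp)) (by positivity)
      exact (h2.trans_le h1).ne'
    have hr0 : ∀ p, 0 ≤ r p := fun p => Finset.prod_nonneg fun i _ =>
      div_nonneg (mul_nonneg (Finset.sum_nonneg fun x _ => Finset.sum_nonneg fun z _ => hT0 _ _ _)
        (hT0 _ _ _)) (Finset.sum_nonneg fun x _ => hT0 _ _ _)
    have hrpos : ∀ p, q p ≠ 0 → r p ≠ 0 := fun p hp =>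
      Finset.prod_ne_zero_iff.2 fun i _ => by
        obtain ⟨a, b, c, f⟩ := marginals_pos hT0 (hmarg p hp i)
        positivity
    have hg := sum_mul_logb_div_nonpos hq0 hr0 hrpos
      (by rw [hq1]; exact sum_prod_letter_le_one hT0 hT1 φ)
    -- On the support of `q` one has q = ∏ P / S, so log (r/q) is the sum of the densities plus log
    -- S.
    have hterm : ∀ p, q p * Real.logb 2 (r p / q p)
        = q p * (∑ i, exponentDensity P T (p.1 i) (p.2 i) (φ p.2 i)) + q p * Real.logb 2 S := by
      intro p
      by_cases hp : q p = 0
      · simp [hp]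
      rw [← mul_add]
      congr 1
      obtain ⟨-, hwp, hPne⟩ := hqne p hp
      have hden : ∀ i, exponentDensity P T (p.1 i) (p.2 i) (φ p.2 i)
          = Real.logb 2 ((∑ x, ∑ z, T x (p.2 i) z) *
            T (p.1 i) (p.2 i) (φ p.2 i) / ∑ x, T x (p.2 i) (φ p.2 i))
            - Real.logb 2 (P (p.1 i, p.2 i)) := fun i => by
        obtain ⟨a, b, c, f⟩ := marginals_pos hT0 (hmarg p hp i)
        rw [exponentDensity, ← Real.logb_div (by positivity) (hPne i), div_div]
      simp only [hden]
      rw [Finset.sum_sub_distrib, ← Real.logb_prod _ _ (Finset.prod_ne_zero_iff.1 (hrpos p hp)),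
        ← Real.logb_prod _ _ (fun i _ => hPne i), ← hwp]
      have hwne : w p ≠ 0 := fun h => hp (by simp [q, h])
      simp only [q]
      rw [Real.logb_div (hrpos p hp) (div_ne_zero hwne hS.ne'), Real.logb_div hwne hS.ne']
      ring
    have hsum : ∑ p, q p * Real.logb 2 (r p / q p)
        = n * exponentObjective P T + Real.logb 2 S := by
      rw [exponentObjective_eq hP hT0 hTac, hexp, Finset.sum_congr rfl fun p _ => hterm p,
        Finset.sum_add_distrib, ← Finset.sum_mul, hq1, one_mul, Finset.mul_sum]
      congr 1
      exact Finset.sum_congr rfl fun p _ => by field_simp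
    rw [hsum] at hg
    have : exponentObjective P T ≤ (-Real.logb 2 S) / n := by
      rw [le_div_iff₀ hn']; linarith
    calc _ ≤ _ := this
      _ = _ := by ring

/-- Achievability: a joint pmf for which the i.i.d. distortion exceeds its budget with
vanishing probability bounds the decay rate from above. -/
theorem eventually_exists_le_mapSuccessProb [Nonempty Z] {P : X × Y → ℝ} (hP : ∀ a, 0 ≤ P a)
    {d : X → Z → ℝ} {Δ : ℝ} {T : X → Y → Z → ℝ} (hT : T ∈ feasibleJoints P d Δ)
    (hd : Tendsto (fun n : ℕ => ∑ a : Fin n → X × Y × Z,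
      if 0 < ∑ i, (d (a i).1 (a i).2.2 - Δ) then ∏ i, T (a i).1 (a i).2.1 (a i).2.2 else 0)
      atTop (𝓝 0)) {ε : ℝ} (hε : 0 < ε) :
    ∀ᶠ n : ℕ in atTop, ∃ φ : (Fin n → Y) → (Fin n → Z),
      1 / 2 * (2 : ℝ) ^ (-((n : ℝ) * (exponentObjective P T + ε))) ≤ mapSuccessProb P d Δ φ := by
  classical
  obtain ⟨h0, h1, -, hac⟩ := hT
  set F := exponentObjective P T with hF
  have hℓ := tendsto_sum_prod_of_mean_neg (A := X × Y × Z)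
    (t := fun a => T a.1 a.2.1 a.2.2)
    (h := fun a => exponentDensity P T a.1 a.2.1 a.2.2 - (F + ε)) (fun a => h0 _ _ _)
    (by simpa only [Fintype.sum_prod_type] using h1) (by
      simp only [Fintype.sum_prod_type, mul_sub, Finset.sum_sub_distrib]
      rw [← exponentObjective_eq hP h0 hac]
      simp only [← Finset.sum_mul, h1]
      linarith)
  have hlim := hd.add hℓ
  rw [add_zero] at hlim
  filter_upwards [hlim.eventually_lt_const (show (0 : ℝ) < 1 / 2 by norm_num),
    eventually_ne_atTop 0] with n hn hn0
  have hn' : (0 : ℝ) < n := by positivity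
  let m : (Fin n → Y) → (Fin n → Z) → ℝ := fun y z =>
    ∑ x : Fin n → X, if avgDistortion d x z ≤ Δ then ∏ i, P (x i, y i) else 0
  have hmax : ∀ y, ∃ z, ∀ z', m y z' ≤ m y z := fun y => Finite.exists_max (m y)
  choose φ hφ using hmax
  refine ⟨φ, ?_⟩
  -- The conditional law T(z|y), equal to 0 if T(y) = 0.
  let c : Y → Z → ℝ := fun y z => (∑ x, T x y z) / ∑ x, ∑ z, T x y z
  have hc0 : ∀ y z, 0 ≤ c y z := fun y z => div_nonneg (Finset.sum_nonneg fun x _ => h0 _ _ _)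
    (Finset.sum_nonneg fun x _ => Finset.sum_nonneg fun z _ => h0 _ _ _)
  have hc1 : ∀ y, ∑ z, c y z ≤ 1 := fun y => by
    simp only [c, ← Finset.sum_div]
    rw [Finset.sum_comm]
    exact div_self_le_one _
  have hm0 : ∀ y z, 0 ≤ m y z := fun y z => Finset.sum_nonneg fun x _ => by
    split_ifs
    · exact Finset.prod_nonneg fun i _ => hP _
    · exact le_rfl
  have hS : mapSuccessProb P d Δ φ = ∑ y, m y (φ y) := by
    rw [mapSuccessProb, Finset.sum_comm]
  -- The maximum over z dominates the average over a random z.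
  have hrand : ∑ y : Fin n → Y, ∑ z : Fin n → Z, (∏ i, c (y i) (z i)) * m y z
      ≤ mapSuccessProb P d Δ φ := by
    rw [hS]
    refine Finset.sum_le_sum fun y _ => ?_
    calc _ ≤ ∑ z : Fin n → Z, (∏ i, c (y i) (z i)) * m y (φ y) :=
          Finset.sum_le_sum fun z _ => mul_le_mul_of_nonneg_left (hφ y z)
            (Finset.prod_nonneg fun i _ => hc0 _ _)
      _ ≤ 1 * m y (φ y) := by
          rw [← Finset.sum_mul, sum_pi_prod_eq_prod_sum fun i z => c (y i) z]
          exact mul_le_mul_of_nonneg_right (Finset.prod_le_one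
            (fun i _ => Finset.sum_nonneg fun z _ => hc0 _ _) fun i _ => hc1 _) (hm0 _ _)
      _ = _ := one_mul _
  refine le_trans ?_ hrand
  have hexpand : ∑ y : Fin n → Y, ∑ z : Fin n → Z, (∏ i, c (y i) (z i)) * m y z
      = ∑ a : Fin n → X × Y × Z, if 0 < ∑ i, (d (a i).1 (a i).2.2 - Δ) then 0 else
        ∏ i, (c (a i).2.1 (a i).2.2 * P ((a i).1, (a i).2.1)) := by
    symm
    rw [sum_pi_prod]
    simp only [sum_pi_prod (A := Y) (B := Z)]
    rw [Finset.sum_comm]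
    refine Finset.sum_congr rfl fun y _ => ?_
    rw [Finset.sum_comm]
    refine Finset.sum_congr rfl fun z _ => ?_
    simp only [m, Finset.mul_sum]
    refine Finset.sum_congr rfl fun x _ => ?_
    have hiff : avgDistortion d x z ≤ Δ ↔ ¬ 0 < ∑ i, (d (x i) (z i) - Δ) := by
      rw [avgDistortion, one_div, inv_mul_le_iff₀ hn', not_lt, Finset.sum_sub_distrib]
      simp
    by_cases hg : avgDistortion d x z ≤ Δ
    · rw [if_pos hg, if_neg (hiff.1 hg), Finset.prod_mul_distrib]
    · rw [if_neg hg, if_pos (not_not.1 (mt hiff.2 hg)), mul_zero]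
  rw [hexpand]
  set V : ℝ := (2 : ℝ) ^ (-((n : ℝ) * (F + ε))) with hV
  have hV0 : 0 < V := Real.rpow_pos_of_pos two_pos _
  have htot : ∑ a : Fin n → X × Y × Z, ∏ i, T (a i).1 (a i).2.1 (a i).2.2 = 1 := by
    rw [sum_pi_prod_eq_prod_sum fun _ (a : X × Y × Z) => T a.1 a.2.1 a.2.2]
    simp only [Fintype.sum_prod_type, h1, Finset.prod_const_one]
  -- Off the two bad events (distortion or density too large) the likelihood ratio is at least `V`;
  -- on them the left side is at most 0. The bad events have total mass below 1/2, whence the factor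
  -- 1/2.
  have hpt : ∀ a : Fin n → X × Y × Z,
      V * ((∏ i, T (a i).1 (a i).2.1 (a i).2.2)
        - ((if 0 < ∑ i, (d (a i).1 (a i).2.2 - Δ) then
            ∏ i, T (a i).1 (a i).2.1 (a i).2.2 else 0)
          + if 0 < ∑ i, (exponentDensity P T (a i).1 (a i).2.1 (a i).2.2 - (F + ε)) then
            ∏ i, T (a i).1 (a i).2.1 (a i).2.2 else 0))
      ≤ if 0 < ∑ i, (d (a i).1 (a i).2.2 - Δ) then 0 else
        ∏ i, (c (a i).2.1 (a i).2.2 * P ((a i).1, (a i).2.1)) := by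
    intro a
    have hT0 : 0 ≤ ∏ i, T (a i).1 (a i).2.1 (a i).2.2 := Finset.prod_nonneg fun i _ => h0 _ _ _
    have hR0 : 0 ≤ ∏ i, (c (a i).2.1 (a i).2.2 * P ((a i).1, (a i).2.1)) :=
      Finset.prod_nonneg fun i _ => mul_nonneg (hc0 _ _) (hP _)
    split_ifs with hA hB hB
    · nlinarith
    · nlinarith
    · simpa using hR0
    · rw [add_zero, sub_zero]
      by_cases hne : ∃ i, T (a i).1 (a i).2.1 (a i).2.2 = 0
      · obtain ⟨i, hi⟩ := hne
        rw [Finset.prod_eq_zero (Finset.mem_univ i) hi, mul_zero]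
        exact hR0
      push Not at hne
      have hlet : ∀ i, c (a i).2.1 (a i).2.2 * P ((a i).1, (a i).2.1)
          = T (a i).1 (a i).2.1 (a i).2.2
            * (2 : ℝ) ^ (-exponentDensity P T (a i).1 (a i).2.1 (a i).2.2) := fun i => by
        obtain ⟨p1, p2, p3, p4⟩ := marginals_pos h0 (hne i)
        have p5 : 0 < P ((a i).1, (a i).2.1) :=
          lt_of_le_of_ne (hP _) fun hh => hne i (hac _ _ _ hh.symm)
        rw [exponentDensity, Real.rpow_neg two_pos.le,
          Real.rpow_logb two_pos (by norm_num) (by positivity)]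
        simp only [c]
        field_simp
      rw [Finset.prod_congr rfl fun i _ => hlet i, Finset.prod_mul_distrib, mul_comm]
      refine mul_le_mul_of_nonneg_left ?_ hT0
      rw [← Real.rpow_sum_of_pos two_pos, hV]
      refine Real.rpow_le_rpow_of_exponent_le one_le_two ?_
      rw [Finset.sum_neg_distrib]
      rw [Finset.sum_sub_distrib] at hB
      simp only [Finset.sum_const, Finset.card_univ, Fintype.card_fin, nsmul_eq_mul] at hB
      linarith
  refine le_trans ?_ (Finset.sum_le_sum fun a _ => hpt a)
  rw [← Finset.mul_sum, Finset.sum_sub_distrib, Finset.sum_add_distrib, htot]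
  nlinarith

end Coding

/-! ### Slack in the distortion constraint and the limit -/

section Exponent

variable [Fintype X] [Fintype Y] [Fintype Z]

/-- Feasible joint pmfs can be approximated, without increasing the objective by much, by feasible
ones whose i.i.d. extension exceeds the distortion budget with vanishing probability. -/
theorem exists_slack_joint {P : X × Y → ℝ} {d : X → Z → ℝ} {Δ : ℝ} {T : X → Y → Z → ℝ}
    (hT : T ∈ feasibleJoints P d Δ) {ε : ℝ} (hε : 0 < ε) :
    ∃ T' ∈ feasibleJoints P d Δ, exponentObjective P T' < exponentObjective P T + ε ∧
      Tendsto (fun n : ℕ => ∑ a : Fin n → X × Y × Z,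
        if 0 < ∑ i, (d (a i).1 (a i).2.2 - Δ) then ∏ i, T' (a i).1 (a i).2.1 (a i).2.2 else 0)
        atTop (𝓝 0) := by
  classical
  obtain ⟨h0, h1, hd, hac⟩ := id hT
  -- If no letter in the support exceeds `Δ`, sequences of positive probability never exceed the
  -- budget, even when the mean equals `Δ`.
  by_cases hA : ∀ x y z, T x y z ≠ 0 → d x z ≤ Δ
  · refine ⟨T, hT, by linarith, ?_⟩
    refine tendsto_const_nhds.congr fun n => (Finset.sum_eq_zero fun a _ => ?_).symm
    split_ifs with hpos
    · by_contra hne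
      replace hne := Finset.prod_ne_zero_iff.1 hne
      exact absurd (Finset.sum_nonpos fun i _ =>
        sub_nonpos.2 (hA _ _ _ (hne i (Finset.mem_univ i)))) (not_le.2 hpos)
    · rfl
  push Not at hA
  obtain ⟨x1, y1, z1, hT1, hd1⟩ := hA
  -- Otherwise some letter in the support lies strictly below `Δ`, as the mean is at most `Δ`. A
  -- little extra mass there makes the mean strict, and continuity controls the objective.
  obtain ⟨x0, y0, z0, hT0, hd0⟩ : ∃ x y z, T x y z ≠ 0 ∧ d x z < Δ := by
    by_contra! hcon
    have hnn : ∀ a : X × Y × Z, 0 ≤ T a.1 a.2.1 a.2.2 * (d a.1 a.2.2 - Δ) := fun a => by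
      rcases eq_or_ne (T a.1 a.2.1 a.2.2) 0 with h | h
      · simp [h]
      · exact mul_nonneg (h0 _ _ _) (sub_nonneg.2 (hcon _ _ _ h))
    have hpos : 0 < ∑ a : X × Y × Z, T a.1 a.2.1 a.2.2 * (d a.1 a.2.2 - Δ) :=
      Finset.sum_pos' (fun a _ => hnn a) ⟨(x1, y1, z1), Finset.mem_univ _,
        mul_pos (lt_of_le_of_ne (h0 _ _ _) hT1.symm) (sub_pos.2 hd1)⟩
    simp only [Fintype.sum_prod_type, mul_sub, Finset.sum_sub_distrib, ← Finset.sum_mul, h1] at hpos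
    linarith
  let D : X → Y → Z → ℝ := fun x y z => if x = x0 ∧ y = y0 ∧ z = z0 then 1 else 0
  have hD : ∀ h : X → Y → Z → ℝ, ∑ x, ∑ y, ∑ z, D x y z * h x y z = h x0 y0 z0 := fun h => by
    rw [Finset.sum_eq_single x0 (fun x _ hx => by simp [D, hx]) (by simp),
      Finset.sum_eq_single y0 (fun y _ hy => by simp [D, hy]) (by simp),
      Finset.sum_eq_single z0 (fun z _ hz => by simp [D, hz]) (by simp)]
    simp [D]
  have hD0 : ∀ x y z, 0 ≤ D x y z := fun x y z => by simp only [D]; split_ifs <;> norm_num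
  let M : ℝ → X → Y → Z → ℝ := fun s x y z => (1 - s) * T x y z + s * D x y z
  have hM : ∀ s (h : X → Y → Z → ℝ), ∑ x, ∑ y, ∑ z, M s x y z * h x y z
      = (1 - s) * (∑ x, ∑ y, ∑ z, T x y z * h x y z) + s * h x0 y0 z0 := fun s h => by
    rw [← hD h]
    simp only [M, add_mul, Finset.sum_add_distrib, Finset.mul_sum, mul_assoc]
  have hM0 : ∀ s ∈ Set.Icc (0 : ℝ) 1, ∀ x y z, 0 ≤ M s x y z := fun s hs x y z =>
    add_nonneg (mul_nonneg (sub_nonneg.2 hs.2) (h0 _ _ _)) (mul_nonneg hs.1 (hD0 _ _ _))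
  have hMzero : M 0 = T := by funext x y z; simp [M]
  have hcont : ContinuousOn (fun s => exponentObjective P (M s)) (Set.Icc 0 1) :=
    (continuousOn_exponentObjective P).comp
      (Continuous.continuousOn (by
        simp only [M]
        exact continuous_pi fun x => continuous_pi fun y => continuous_pi fun z => by fun_prop))
      hM0
  have h0mem : (0 : ℝ) ∈ Set.Icc (0 : ℝ) 1 := ⟨le_rfl, zero_le_one⟩
  have hlt := (hcont 0 h0mem).eventually_lt_const
    (show exponentObjective P (M 0) < exponentObjective P T + ε by rw [hMzero]; linarith)
  have hlt' : ∀ᶠ s in 𝓝[>] (0 : ℝ), exponentObjective P (M s) < exponentObjective P T + ε := by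
    rw [← nhdsWithin_Ioc_eq_nhdsGT zero_lt_one]
    exact hlt.filter_mono (nhdsWithin_mono _ Set.Ioc_subset_Icc_self)
  have hIoc : ∀ᶠ s in 𝓝[>] (0 : ℝ), s ∈ Set.Ioc (0 : ℝ) 1 := Ioc_mem_nhdsGT zero_lt_one
  obtain ⟨s, hs, hs0, hs1⟩ := (hlt'.and hIoc).exists
  have hsI : s ∈ Set.Icc (0 : ℝ) 1 := ⟨hs0.le, hs1⟩
  have hM1 : ∑ x, ∑ y, ∑ z, M s x y z = 1 := by
    have := hM s fun _ _ _ => 1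
    simp only [mul_one, h1] at this
    linarith
  have hMd : ∑ x, ∑ y, ∑ z, M s x y z * d x z < Δ := by
    rw [hM s fun x _ z => d x z]
    nlinarith [mul_le_mul_of_nonneg_left hd (sub_nonneg.2 hs1), mul_lt_mul_of_pos_left hd0 hs0]
  refine ⟨M s, ⟨hM0 s hsI, hM1, hMd.le, fun x y z hxy => ?_⟩, hs, ?_⟩
  · have hne : ¬ (x = x0 ∧ y = y0 ∧ z = z0) := by
      rintro ⟨rfl, rfl, rfl⟩
      exact hT0 (hac _ _ _ hxy)
    simp [M, D, hne, hac _ _ z hxy]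
  · refine tendsto_sum_prod_of_mean_neg (A := X × Y × Z) (t := fun a => M s a.1 a.2.1 a.2.2)
      (h := fun a => d a.1 a.2.2 - Δ) (fun a => hM0 s hsI _ _ _)
      (by simpa only [Fintype.sum_prod_type] using hM1) ?_
    simp only [Fintype.sum_prod_type, mul_sub, Finset.sum_sub_distrib, ← Finset.sum_mul, hM1]
    linarith

/-- The decay rate converges to the least value of the objective over the feasible joint pmfs. -/
theorem isExponent_of_isMinOn [Nonempty Z] {P : X × Y → ℝ} (hP : ∀ a, 0 ≤ P a) {d : X → Z → ℝ}
    {R Δ : ℝ} (hR : Real.logb 2 (Fintype.card Z : ℝ) ≤ R) {T : X → Y → Z → ℝ}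
    (hT : T ∈ feasibleJoints P d Δ) (hmin : IsMinOn (exponentObjective P) (feasibleJoints P d Δ) T) :
    IsExponent P d R Δ ((exponentObjective P T : ℝ) : EReal) := by
  set p : ℕ → ℝ := fun n => maxSuccessProb P d n R Δ with hp
  have hlow : ∀ ε : ℝ, 0 < ε → ∀ᶠ n : ℕ in atTop,
      1 / 2 * (2 : ℝ) ^ (-((n : ℝ) * (exponentObjective P T + ε))) ≤ p n := fun ε hε => by
    obtain ⟨T', hT', hlt, htend⟩ := exists_slack_joint hT (half_pos hε)
    filter_upwards [eventually_exists_le_mapSuccessProb hP hT' htend (half_pos hε)] with n hn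
    obtain ⟨φ, hφ⟩ := hn
    refine le_trans ?_ (hφ.trans (mapSuccessProb_le_max P d hR Δ φ))
    refine mul_le_mul_of_nonneg_left (Real.rpow_le_rpow_of_exponent_le one_le_two ?_) (by norm_num)
    exact neg_le_neg (mul_le_mul_of_nonneg_left (by linarith) n.cast_nonneg)
  have hpos : ∀ᶠ n : ℕ in atTop, 0 < p n := by
    filter_upwards [hlow 1 one_pos] with n hn
    exact lt_of_lt_of_le (by positivity) hn
  have htend : Tendsto (fun n : ℕ => -(1 / (n : ℝ)) * Real.logb 2 (p n)) atTop
      (𝓝 (exponentObjective P T)) := by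
    refine tendsto_order.2 ⟨fun a ha => ?_, fun b hb => ?_⟩
    · filter_upwards [hpos, eventually_ne_atTop 0] with n hn hn0
      obtain ⟨φ, hφ⟩ := exists_mapSuccessProb_eq_max P d hR Δ n
      obtain ⟨T', hT', hle⟩ := exists_objective_le hP d Δ hn0 φ (by rw [hφ]; exact hn)
      rw [hφ] at hle
      exact ha.trans_le ((hmin hT').trans hle)
    -- Half the gap is loss in the exponent; the other half absorbs the 1/n coming from the factor
    -- 1/2.
    · set ε := (b - exponentObjective P T) / 2 with hε
      have hε0 : 0 < ε := half_pos (sub_pos.2 hb)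
      have hinv := tendsto_one_div_atTop_nhds_zero_nat (𝕜 := ℝ)
      filter_upwards [hlow ε hε0, hinv.eventually_lt_const hε0, eventually_ne_atTop 0]
        with n hn hsmall hn0
      have hn' : (0 : ℝ) < n := by positivity
      have hlog := Real.logb_le_logb_of_le one_lt_two (by positivity) hn
      rw [Real.logb_mul (by norm_num) (by positivity), Real.logb_rpow two_pos (by norm_num),
        one_div, Real.logb_inv, Real.logb_self_eq_one one_lt_two] at hlog
      have h2 := mul_le_mul_of_nonneg_left hlog (by positivity : (0 : ℝ) ≤ 1 / n)
      have h3 : 1 / (n : ℝ) * (-1 + -((n : ℝ) * (exponentObjective P T + ε)))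
          = -(1 / (n : ℝ)) - (exponentObjective P T + ε) := by
        field_simp
        ring
      rw [h3] at h2
      linarith
  refine ((continuous_coe_real_ereal.tendsto _).comp htend).congr' ?_
  filter_upwards [hpos] with n hn
  simp only [Function.comp, decayRate]
  rw [if_neg hn.ne']

/-- By the converse, one success of positive probability at some n ≥ 1 would already produce a
feasible joint pmf. -/
theorem isExponent_top [Nonempty Z] {P : X × Y → ℝ} (hP : ∀ a, 0 ≤ P a) {d : X → Z → ℝ}
    {R Δ : ℝ} (hR : Real.logb 2 (Fintype.card Z : ℝ) ≤ R)
    (hK : ¬ (feasibleJoints P d Δ).Nonempty) : IsExponent P d R Δ ⊤ := by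
  refine tendsto_const_nhds.congr' ?_
  filter_upwards [eventually_ne_atTop 0] with n hn0
  obtain ⟨φ, hφ⟩ := exists_mapSuccessProb_eq_max P d hR Δ n
  rcases (mapSuccessProb_nonneg hP d Δ φ).eq_or_lt with h | h
  · rw [decayRate, if_pos (by rw [← hφ, ← h])]
  · obtain ⟨T, hT, -⟩ := exists_objective_le hP d Δ hn0 φ h
    exact absurd ⟨T, hT⟩ hK

/-- A pmf `Q` whose value is finite has a feasible joint pmf with that value. -/
theorem value_eq_top_or_exists {P Q : X × Y → ℝ} (hQ : Q ∈ stdSimplex ℝ (X × Y)) (d : X → Z → ℝ)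
    (Δ : ℝ) : relEntropy Q P + condRateDistortion d Q Δ = ⊤ ∨
      ∃ T ∈ feasibleJoints P d Δ,
        relEntropy Q P + condRateDistortion d Q Δ = ((exponentObjective P T : ℝ) : EReal) := by
  by_cases hne : (feasibleChannels d Q Δ).Nonempty
  · obtain ⟨⟨W, hW, hWeq⟩, -⟩ := isLeast_condRateDistortion d hQ.1 hne
    rw [← hWeq]
    by_cases hac : ∀ a, P a = 0 → Q a = 0
    · exact Or.inr ⟨_, joint_mem_feasibleJoints hQ hac hW, relEntropy_add_condMutualInfo hac hW.1⟩
    · left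
      rw [relEntropy, if_neg hac]
      exact EReal.top_add_coe _
  · left
    have : condRateDistortion d Q Δ = ⊤ := by
      rw [condRateDistortion, Set.not_nonempty_iff_eq_empty.1 hne]
      simp
    rw [this, relEntropy]
    split_ifs
    · exact EReal.coe_add_top _
    · exact EReal.top_add_top

end Exponent

end RemoteLossy

/-! ### Main theorem -/

theorem corollary1 {X Y Z : Type*} [Fintype X] [Fintype Y] [Fintype Z] [Nonempty Z]
    (P : X × Y → ℝ) (hP : P ∈ stdSimplex ℝ (X × Y))
    (d : X → Z → ℝ) (hd : ∀ x z, 0 ≤ d x z)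
    (R Δ : ℝ) (hR : Real.logb 2 (Fintype.card Z : ℝ) ≤ R) :
    (∃ E : EReal, RemoteLossy.IsExponent P d R Δ E ∧
      IsLeast ((fun Q : X × Y → ℝ =>
        RemoteLossy.relEntropy Q P + RemoteLossy.condRateDistortion d Q Δ) ''
          stdSimplex ℝ (X × Y)) E) ∧
    (∀ Q ∈ stdSimplex ℝ (X × Y), (RemoteLossy.feasibleChannels d Q Δ).Nonempty →
      IsLeast ((fun W : X × Y → Z → ℝ =>
        ((RemoteLossy.condMutualInfo (RemoteLossy.joint Q W) : ℝ) : EReal)) ''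
          RemoteLossy.feasibleChannels d Q Δ) (RemoteLossy.condRateDistortion d Q Δ)) := by
  refine ⟨?_, fun Q hQ hne => RemoteLossy.isLeast_condRateDistortion d hQ.1 hne⟩
  by_cases hK : (RemoteLossy.feasibleJoints P d Δ).Nonempty
  · obtain ⟨T, hT, hmin⟩ := (RemoteLossy.isCompact_feasibleJoints P d Δ).exists_isMinOn hK
      ((RemoteLossy.continuousOn_exponentObjective P).mono fun T hT => hT.1)
    have hlower : ∀ Q ∈ stdSimplex ℝ (X × Y),
        ((RemoteLossy.exponentObjective P T : ℝ) : EReal)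
          ≤ RemoteLossy.relEntropy Q P + RemoteLossy.condRateDistortion d Q Δ := fun Q hQ => by
      rcases RemoteLossy.value_eq_top_or_exists hQ d Δ with h | ⟨T', hT', h⟩
      · rw [h]; exact le_top
      · rw [h]; exact EReal.coe_le_coe_iff.2 (hmin hT')
    refine ⟨_, RemoteLossy.isExponent_of_isMinOn hP.1 hR hT hmin, ?_, ?_⟩
    · obtain ⟨Q, hQ, hac, W, hW, rfl⟩ := RemoteLossy.exists_joint_eq hT
      refine ⟨Q, hQ, le_antisymm ?_ (hlower Q hQ)⟩
      rw [← RemoteLossy.relEntropy_add_condMutualInfo hac hW.1]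
      exact add_le_add le_rfl (iInf₂_le W hW)
    · rintro _ ⟨Q, hQ, rfl⟩
      exact hlower Q hQ
  · have htop : ∀ Q ∈ stdSimplex ℝ (X × Y),
        RemoteLossy.relEntropy Q P + RemoteLossy.condRateDistortion d Q Δ = ⊤ := fun Q hQ =>
      (RemoteLossy.value_eq_top_or_exists hQ d Δ).resolve_right fun ⟨T, hT, _⟩ => hK ⟨T, hT⟩
    -- All values are infinite, so any pmf attains the minimum; `P` is at hand.
    refine ⟨⊤, RemoteLossy.isExponent_top hP.1 hR hK, ⟨P, hP, htop P hP⟩, ?_⟩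
    rintro _ ⟨Q, hQ, rfl⟩
    exact (htop Q hQ).ge
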